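/- Let $n\ge 0$ and $[n]=\{1,\dots,n\}$. A set partition of $[n]$ is noncrossing if there are no $a<b<c<d$ with $a,c$ in one block and $b,d$ in another block. A singleton is a block with exactly one element. A (circular) adjacency of a partition of $[n]$ is an element $i\in[n]$ that lies in the same block as its cyclic successor, which is $i+1$ if $i<n$ and $1$ if $i=n$ (so for $n=1$ the only partition has one singleton and one adjacency, and for $n=2$ the one-block partition has two adjacencies). Let $R$ be the rotation operator on set partitions of $[n]$ that replaces each element $i$ of every block by its cyclic successor; a circular noncrossing partition of $n$ points is a rotation class of noncrossing partitions of $[n]$, that is, a class modulo $\pi\sim R^{k}\pi$, $k\in\mathbb{Z}$. The numbers of singletons and of adjacencies are invariant under $R$, and so are defined on circular noncrossing partitions. Then on noncrossing partitions of $[n]$, and also on circular noncrossing partitions of $n$ points, the statistics "number of singletons" and "number of adjacencies" have a symmetric joint distribution: for all $s,t\ge 0$, the number of (circular) noncrossing partitions with exactly $s$ singletons and $t$ adjacencies equals the number of those with exactly $t$ singletons and $s$ adjacencies. In particular the two statistics have the same distribution: for every $k\ge 0$, as many (circular) noncrossing partitions have exactly $k$ singletons as have exactly $k$ adjacencies.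 -/

import Mathlib

/-- A set partition of `[n]`; the elements `1, …, n` are represented by `Fin n` in the same order. -/
abbrev SetPartition (n : ℕ) : Type := Finpartition (Finset.univ : Finset (Fin n))

namespace SetPartition

/-- No `a < b < c < d` with `a, c` in one block and `b, d` in another block. -/
def NonCrossing {n : ℕ} (P : SetPartition n) : Prop :=
  ¬ ∃ a b c d : Fin n, a < b ∧ b < c ∧ c < d ∧
    ∃ B ∈ P.parts, ∃ B' ∈ P.parts, B ≠ B' ∧ a ∈ B ∧ c ∈ B ∧ b ∈ B' ∧ d ∈ B'

/-- The number of blocks with exactly one element. -/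
def numSingletons {n : ℕ} (P : SetPartition n) : ℕ :=
  (P.parts.filter (fun B => B.card = 1)).card

/-- The number of circular adjacencies: the elements `i` of `[n]` whose cyclic successor
`finRotate n i` (that is, `i + 1`, or the first element if `i` is the last one) lies in the same
block as `i`. -/
def numAdjacencies {n : ℕ} (P : SetPartition n) : ℕ :=
  (Finset.univ.filter
    (fun i : Fin n => ∃ B ∈ P.parts, i ∈ B ∧ finRotate n i ∈ B)).card

/-- Apply a permutation of `[n]` elementwise to the blocks of a partition. -/
def relabel {n : ℕ} (e : Equiv.Perm (Fin n)) (P : SetPartition n) : SetPartition n :=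
  Finpartition.ofExistsUnique (P.parts.map e.finsetCongr.toEmbedding)
    (fun _ _ => Finset.subset_univ _)
    (by
      intro x _
      obtain ⟨B, ⟨hB, hx⟩, huniq⟩ := P.existsUnique_mem (Finset.mem_univ (e.symm x))
      refine ⟨e.finsetCongr B, ⟨Finset.mem_map_of_mem _ hB, ?_⟩, ?_⟩
      · simpa [Finset.mem_map_equiv] using hx
      · rintro B' ⟨hB', hx'⟩
        obtain ⟨C, hC, rfl⟩ := Finset.mem_map.1 hB'
        have hxC : e.symm x ∈ C := by simpa [Finset.mem_map_equiv] using hx'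
        rw [huniq C ⟨hC, hxC⟩]
        rfl)
    (by
      intro h
      obtain ⟨C, hC, hC'⟩ := Finset.mem_map.1 h
      have : C = ∅ := by simpa using hC'
      exact P.empty_notMem_parts (this ▸ hC))

theorem relabel_parts {n : ℕ} (e : Equiv.Perm (Fin n)) (P : SetPartition n) :
    (relabel e P).parts = P.parts.map e.finsetCongr.toEmbedding := rfl

/-- The rotation operator `R` on partitions of `[n]`, induced by `i ↦ i + 1 (mod n)`. -/
def rotation (n : ℕ) : Equiv.Perm (SetPartition n) where
  toFun := relabel (finRotate n)
  invFun := relabel (finRotate n).symm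
  left_inv P := by
    ext B
    simp [relabel_parts, Finset.map_map]
  right_inv P := by
    ext B
    simp [relabel_parts, Finset.map_map]

theorem rotation_parts {n : ℕ} (P : SetPartition n) :
    (rotation n P).parts = P.parts.map (finRotate n).finsetCongr.toEmbedding := rfl

theorem numSingletons_rotation {n : ℕ} (P : SetPartition n) :
    numSingletons (rotation n P) = numSingletons P := by
  unfold numSingletons
  rw [rotation_parts, Finset.filter_map, Finset.card_map]
  congr 1
  ext B
  simp

theorem numAdjacencies_rotation {n : ℕ} (P : SetPartition n) :
    numAdjacencies (rotation n P) = numAdjacencies P := by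
  unfold numAdjacencies
  symm
  refine Finset.card_equiv (finRotate n) ?_
  intro i
  simp only [Finset.mem_filter, Finset.mem_univ, true_and]
  rw [rotation_parts]
  constructor
  · rintro ⟨B, hB, h₁, h₂⟩
    exact ⟨_, Finset.mem_map_of_mem _ hB, Finset.mem_map_of_mem _ h₁,
      Finset.mem_map_of_mem _ h₂⟩
  · rintro ⟨B', hB', h₁, h₂⟩
    obtain ⟨B, hB, rfl⟩ := Finset.mem_map.1 hB'
    exact ⟨B, hB, (Finset.mem_map' (finRotate n).toEmbedding).1 h₁,
      (Finset.mem_map' (finRotate n).toEmbedding).1 h₂⟩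

theorem eq_of_sameCycle {α β : Type*} {f : Equiv.Perm α} {g : α → β}
    (hg : ∀ x, g (f x) = g x) {x y : α} (h : f.SameCycle x y) : g x = g y := by
  obtain ⟨i, rfl⟩ := h
  have key : ∀ (k : ℕ) (z : α), g ((f ^ k) z) = g z := by
    intro k
    induction k with
    | zero => intro z; simp
    | succ k ih => intro z; rw [pow_succ', Equiv.Perm.mul_apply, hg, ih]
  cases i with
  | ofNat k => simpa using (key k x).symm
  | negSucc k =>
    have := key (k + 1) ((f ^ (Int.negSucc k)) x)
    simpa [zpow_negSucc] using this

end SetPartition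

/-- Noncrossing partitions of `[n]`. -/
def NCPartition (n : ℕ) : Type := {P : SetPartition n // P.NonCrossing}

namespace NCPartition

def numSingletons {n : ℕ} (P : NCPartition n) : ℕ := SetPartition.numSingletons P.1

def numAdjacencies {n : ℕ} (P : NCPartition n) : ℕ := SetPartition.numAdjacencies P.1

/-- Two noncrossing partitions are rotation equivalent if a power of the rotation operator maps
one to the other. -/
def rotationSetoid (n : ℕ) : Setoid (NCPartition n) :=
  (Equiv.Perm.SameCycle.setoid (SetPartition.rotation n)).comap Subtype.val

end NCPartition

/-- Circular noncrossing partitions of `n` points: rotation classes of noncrossing partitions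
of `[n]`. -/
def CircularNCPartition (n : ℕ) : Type := Quotient (NCPartition.rotationSetoid n)

namespace CircularNCPartition

/-- The number of singleton blocks of any representative. -/
def numSingletons {n : ℕ} (A : CircularNCPartition n) : ℕ :=
  Quotient.lift NCPartition.numSingletons
    (fun _ _ h => SetPartition.eq_of_sameCycle
      SetPartition.numSingletons_rotation h) A

/-- The number of circular adjacencies of any representative. -/
def numAdjacencies {n : ℕ} (A : CircularNCPartition n) : ℕ :=
  Quotient.lift NCPartition.numAdjacencies
    (fun _ _ h => SetPartition.eq_of_sameCycle
      SetPartition.numAdjacencies_rotation h) A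

end CircularNCPartition

/-! The Kreweras complement K exchanges the two statistics. Put a new point i + 1/2 in the gap after
each i, and join two new points when no chord inside a block of P separates them. The points on
either side of i + 1 are joined exactly when no chord has i + 1 as its only endpoint there, that is,
when {i + 1} is a block: adjacencies of K P are singletons of P
(`numAdjacencies_krewerasComplement`).

The other half follows from K² = R⁻¹ on noncrossing partitions
(`NonCrossing.krewerasComplement_krewerasComplement`): the singletons of K P are the adjacencies of
K² P = R⁻¹ P, as many as those of P. The same identity makes K bijective and makes it commute with
R, so it descends to rotation classes. -/

namespace SetPartition

/-- Two elements lie in the same block. -/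
def SameBlock {n : ℕ} (P : SetPartition n) (i j : Fin n) : Prop :=
  ∃ B ∈ P.parts, i ∈ B ∧ j ∈ B

theorem sameBlock_iff {n : ℕ} {P : SetPartition n} {i j : Fin n} :
    P.SameBlock i j ↔ P.part i = P.part j := by
  constructor
  · rintro ⟨B, hB, hi, hj⟩
    rw [P.part_eq_of_mem hB hi, P.part_eq_of_mem hB hj]
  · intro h
    exact ⟨P.part i, P.part_mem.2 (Finset.mem_univ i), P.mem_part (Finset.mem_univ i),
      h ▸ P.mem_part (Finset.mem_univ j)⟩

theorem SameBlock.refl {n : ℕ} (P : SetPartition n) (i : Fin n) : P.SameBlock i i :=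
  sameBlock_iff.2 rfl

theorem SameBlock.symm {n : ℕ} {P : SetPartition n} {i j : Fin n} (h : P.SameBlock i j) :
    P.SameBlock j i :=
  sameBlock_iff.2 (sameBlock_iff.1 h).symm

theorem SameBlock.trans {n : ℕ} {P : SetPartition n} {i j k : Fin n} (h : P.SameBlock i j)
    (h' : P.SameBlock j k) : P.SameBlock i k :=
  sameBlock_iff.2 ((sameBlock_iff.1 h).trans (sameBlock_iff.1 h'))

theorem mem_parts_iff {n : ℕ} {P : SetPartition n} {B : Finset (Fin n)} :
    B ∈ P.parts ↔ ∃ i, ∀ j, j ∈ B ↔ P.SameBlock i j := by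
  constructor
  · intro hB
    obtain ⟨i, hi⟩ := P.nonempty_of_mem_parts hB
    refine ⟨i, fun j => ⟨fun hj => ⟨B, hB, hi, hj⟩, ?_⟩⟩
    rintro ⟨C, hC, hiC, hjC⟩
    rwa [P.eq_of_mem_parts hB hC hi hiC]
  · rintro ⟨i, hi⟩
    have : B = P.part i := by
      ext j
      rw [hi, sameBlock_iff, P.mem_part_iff_part_eq_part (Finset.mem_univ _) (Finset.mem_univ _),
        eq_comm]
    rw [this]
    exact P.part_mem.2 (Finset.mem_univ i)

theorem ext_sameBlock {n : ℕ} {P Q : SetPartition n}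
    (h : ∀ i j, P.SameBlock i j ↔ Q.SameBlock i j) : P = Q := by
  ext B
  simp only [mem_parts_iff, h]

theorem nonCrossing_iff {n : ℕ} {P : SetPartition n} :
    P.NonCrossing ↔ ∀ a b c d : Fin n, a < b → b < c → c < d →
      P.SameBlock a c → P.SameBlock b d → P.SameBlock a b := by
  constructor
  · rintro h a b c d hab hbc hcd ⟨B, hB, ha, hc⟩ ⟨B', hB', hb, hd⟩
    by_cases hBB : B = B'
    · exact ⟨B, hB, ha, hBB ▸ hb⟩
    · exact (h ⟨a, b, c, d, hab, hbc, hcd, B, hB, B', hB', hBB, ha, hc, hb, hd⟩).elim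
  · rintro h ⟨a, b, c, d, hab, hbc, hcd, B, hB, B', hB', hBB, ha, hc, hb, hd⟩
    obtain ⟨C, hC, haC, hbC⟩ := h a b c d hab hbc hcd ⟨B, hB, ha, hc⟩ ⟨B', hB', hb, hd⟩
    exact hBB ((P.eq_of_mem_parts hB hC ha haC).trans (P.eq_of_mem_parts hC hB' hbC hb))

/-! ### The cyclic successor and the Kreweras complement -/

theorem val_finRotate {n : ℕ} (i : Fin n) :
    (finRotate n i : ℕ) = if (i : ℕ) + 1 = n then 0 else (i : ℕ) + 1 := by
  obtain _ | n := n
  · exact i.elim0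
  · rw [coe_finRotate]
    simp [Fin.ext_iff]

/-- At the last i the successor wraps to the first element, so both inequalities fail for every x.
Whether the equivalence holds thus depends on i alone, and the exception cancels when two values of
x are compared. -/
theorem lt_finRotate_iff {n : ℕ} (i x : Fin n) :
    (x < finRotate n i ↔ ¬ i < x) ↔ (i : ℕ) + 1 ≠ n := by
  have := val_finRotate i
  rw [Fin.lt_def, Fin.lt_def]
  split_ifs at this <;> omega

theorem sameBlock_rotation_symm {n : ℕ} {P : SetPartition n} {i j : Fin n} :
    ((rotation n).symm P).SameBlock i j ↔ P.SameBlock (finRotate n i) (finRotate n j) := by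
  change (∃ B ∈ P.parts.map (finRotate n).symm.finsetCongr.toEmbedding, i ∈ B ∧ j ∈ B) ↔ _
  constructor
  · rintro ⟨B', hB', hi, hj⟩
    obtain ⟨B, hB, rfl⟩ := Finset.mem_map.1 hB'
    exact ⟨B, hB, Finset.mem_map_equiv.1 hi, Finset.mem_map_equiv.1 hj⟩
  · rintro ⟨B, hB, hi, hj⟩
    exact ⟨_, Finset.mem_map_of_mem _ hB, Finset.mem_map_equiv.2 hi, Finset.mem_map_equiv.2 hj⟩

/-- The Kreweras complement of a set partition. Think of `i` as placed between the points `i` and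
`i + 1` of the circle: two of these new points are in the same block if no chord between elements
of a block of `P` separates them. -/
noncomputable def krewerasComplement {n : ℕ} (P : SetPartition n) : SetPartition n :=
  open scoped Classical in
  Finpartition.ofSetoid
    { r := fun i j => ∀ x y, P.SameBlock x y → ((i < x ↔ i < y) ↔ (j < x ↔ j < y))
      iseqv :=
        { refl := fun _ _ _ _ => Iff.rfl
          symm := fun h x y hxy => (h x y hxy).symm
          trans := fun h h' x y hxy => (h x y hxy).trans (h' x y hxy) } }

theorem sameBlock_krewerasComplement {n : ℕ} {P : SetPartition n} {i j : Fin n} :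
    P.krewerasComplement.SameBlock i j ↔
      ∀ x y, P.SameBlock x y → ((i < x ↔ i < y) ↔ (j < x ↔ j < y)) := by
  classical
  rw [sameBlock_iff, eq_comm,
    ← Finpartition.mem_part_iff_part_eq_part _ (Finset.mem_univ _) (Finset.mem_univ _)]
  exact Finpartition.mem_part_ofSetoid_iff_rel

/-- Along the line the side of a chord changes at most twice, so it cannot alternate over a < b < c
< d. This needs no assumption on P. -/
theorem nonCrossing_krewerasComplement {n : ℕ} (P : SetPartition n) :
    P.krewerasComplement.NonCrossing := by
  rw [nonCrossing_iff]
  intro a b c d hab hbc hcd hac hbd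
  rw [sameBlock_krewerasComplement] at *
  intro x y hxy
  have h₁ := hac x y hxy
  have h₂ := hbd x y hxy
  omega

/-- In a noncrossing partition, the interval spanned by a block is a union of blocks. -/
theorem NonCrossing.sameBlock_krewerasComplement_of_isLeast_of_isGreatest {n : ℕ}
    {P : SetPartition n} (hP : P.NonCrossing) {b m M p : Fin n}
    (hm : IsLeast {x | P.SameBlock b x} m) (hM : IsGreatest {x | P.SameBlock b x} M)
    (hp : (p : ℕ) + 1 = m) : P.krewerasComplement.SameBlock p M := by
  rw [nonCrossing_iff] at hP
  have key : ∀ x y, P.SameBlock x y → m ≤ x → x ≤ M → m ≤ y ∧ y ≤ M := by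
    intro x y hxy hmx hxM
    by_cases hx : P.SameBlock b x
    · exact ⟨hm.2 (hx.trans hxy), hM.2 (hx.trans hxy)⟩
    have hmx' : m < x := lt_of_le_of_ne hmx fun h => hx (h ▸ hm.1)
    have hxM' : x < M := lt_of_le_of_ne hxM fun h => hx (h ▸ hM.1)
    have hmM : P.SameBlock m M := SameBlock.trans (SameBlock.symm hm.1) hM.1
    by_contra hy
    apply hx
    rw [not_and_or, not_le, not_le] at hy
    obtain hy | hy := hy
    · exact SameBlock.trans hm.1 ((hP y m x M hy hmx' hxM' hxy.symm hmM).symm.trans hxy.symm)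
    · exact SameBlock.trans hm.1 (hP m x M y hmx' hxM' hy hmM hxy)
  -- By `key` a chord has both endpoints in [m, M] or neither, so it does not separate the gap
  -- before m from the gap after M.
  rw [sameBlock_krewerasComplement]
  intro x y hxy
  have h₁ := key x y hxy
  have h₂ := key y x hxy.symm
  have hmM : m ≤ M := hM.2 hm.1
  simp only [Fin.lt_def, Fin.le_def] at *
  omega

theorem exists_isLeast_isGreatest {n : ℕ} (P : SetPartition n) (b : Fin n) :
    ∃ m M, IsLeast {x | P.SameBlock b x} m ∧ IsGreatest {x | P.SameBlock b x} M := by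
  have hfin := Set.toFinite {x | P.SameBlock b x}
  have hne : {x | P.SameBlock b x}.Nonempty := ⟨b, SameBlock.refl P b⟩
  obtain ⟨m, hm⟩ := Set.exists_min_image _ id hfin hne
  obtain ⟨M, hM⟩ := Set.exists_max_image _ id hfin hne
  exact ⟨m, M, ⟨hm.1, fun x hx => hm.2 x hx⟩, ⟨hM.1, fun x hx => hM.2 x hx⟩⟩

/-- The separating chord joins the gaps just outside the span of one block. If the block of b has an
element e < a, the block of a is trapped strictly between e and b, and its span is used. Otherwise
the block of b lies to the right of a, and its span is used. In both cases some element precedes the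
minimum m, so m - 1 exists. -/
theorem NonCrossing.exists_separating {n : ℕ} {P : SetPartition n} (hP : P.NonCrossing)
    {a b : Fin n} (hab : a < b) (h : ¬ P.SameBlock a b) :
    ∃ x y, P.krewerasComplement.SameBlock x y ∧
      ¬ ((x < a ↔ x < b) ↔ (y < a ↔ y < b)) := by
  by_cases hB : ∃ e, e < a ∧ P.SameBlock b e
  · obtain ⟨e, hea, hbe⟩ := hB
    obtain ⟨m, M, hm, hM⟩ := P.exists_isLeast_isGreatest a
    have hma : m ≤ a := hm.2 (SameBlock.refl P a)
    have haM : a ≤ M := hM.2 (SameBlock.refl P a)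
    have ham : P.SameBlock a m := hm.1
    have haM' : P.SameBlock a M := hM.1
    have hnc := nonCrossing_iff.1 hP
    have hMb : M < b := by
      by_contra! hbM
      have hbM' : b < M := lt_of_le_of_ne hbM fun h' => h (h' ▸ haM')
      exact h ((hnc e a b M hea hab hbM' hbe.symm haM').symm.trans hbe.symm)
    have hem : e < m := by
      by_contra! hme
      have hme' : m < e := lt_of_le_of_ne hme fun h' => h (ham.trans (h' ▸ hbe.symm))
      exact h (ham.trans ((hnc m e a b hme' hea hab ham.symm hbe.symm).trans hbe.symm))
    rw [Fin.lt_def] at hem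
    refine ⟨⟨m - 1, by omega⟩, M,
      hP.sameBlock_krewerasComplement_of_isLeast_of_isGreatest hm hM ?_, ?_⟩ <;>
    simp only [Fin.lt_def, Fin.le_def] at * <;> omega
  · push Not at hB
    obtain ⟨m, M, hm, hM⟩ := P.exists_isLeast_isGreatest b
    have hmb : m ≤ b := hm.2 (SameBlock.refl P b)
    have hbM : b ≤ M := hM.2 (SameBlock.refl P b)
    have ham : a < m := by
      refine lt_of_le_of_ne (not_lt.1 fun h' => hB m h' hm.1) ?_
      rintro rfl
      exact h (SameBlock.symm hm.1)
    rw [Fin.lt_def] at ham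
    refine ⟨⟨m - 1, by omega⟩, M,
      hP.sameBlock_krewerasComplement_of_isLeast_of_isGreatest hm hM ?_, ?_⟩ <;>
    simp only [Fin.lt_def, Fin.le_def] at * <;> omega

/-- The square of the Kreweras complement is the inverse of the rotation. -/
theorem NonCrossing.krewerasComplement_krewerasComplement {n : ℕ} {P : SetPartition n}
    (hP : P.NonCrossing) : P.krewerasComplement.krewerasComplement = (rotation n).symm P := by
  refine ext_sameBlock fun i j => ?_
  rw [sameBlock_rotation_symm, sameBlock_krewerasComplement]
  -- Separation is symmetric in the two chords. The gap after i + 1/2 contains the original point i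
  -- + 1, which is where the rotation comes from.
  have hside : ∀ x y : Fin n, ((i < x ↔ i < y) ↔ (j < x ↔ j < y)) ↔
      ((x < finRotate n i ↔ x < finRotate n j) ↔ (y < finRotate n i ↔ y < finRotate n j)) := by
    intro x y
    have h₁ := lt_finRotate_iff i x
    have h₂ := lt_finRotate_iff j x
    have h₃ := lt_finRotate_iff i y
    have h₄ := lt_finRotate_iff j y
    simp only [Fin.lt_def] at *
    omega
  simp only [hside]
  constructor
  · intro h
    by_contra hij
    obtain hlt | heq | hlt := lt_trichotomy (finRotate n i) (finRotate n j)
    · obtain ⟨x, y, hxy, hne⟩ := hP.exists_separating hlt hij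
      exact hne (h x y hxy)
    · exact hij (heq ▸ SameBlock.refl P _)
    · obtain ⟨x, y, hxy, hne⟩ := hP.exists_separating hlt fun h' => hij h'.symm
      have := h x y hxy
      simp only [Fin.lt_def] at *
      omega
  · intro h x y hxy
    exact sameBlock_krewerasComplement.1 hxy _ _ h

/-! ### Exchange of singletons and adjacencies -/

theorem singleton_mem_parts_iff {n : ℕ} {P : SetPartition n} {i : Fin n} :
    {i} ∈ P.parts ↔ ∀ x y, P.SameBlock x y → (x = i ↔ y = i) := by
  rw [mem_parts_iff]
  constructor
  · rintro ⟨k, hk⟩ x y hxy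
    simp only [Finset.mem_singleton] at hk
    rw [hk, hk]
    exact ⟨fun h => h.trans hxy, fun h => h.trans hxy.symm⟩
  · intro h
    refine ⟨i, fun j => ?_⟩
    rw [Finset.mem_singleton]
    refine ⟨?_, fun hij => (h i j hij).1 rfl⟩
    rintro rfl
    exact SameBlock.refl P j

theorem sameBlock_krewerasComplement_finRotate {n : ℕ} {P : SetPartition n} {i : Fin n} :
    P.krewerasComplement.SameBlock i (finRotate n i) ↔ {finRotate n i} ∈ P.parts := by
  rw [sameBlock_krewerasComplement, singleton_mem_parts_iff]
  refine forall₃_congr fun x y _ => ?_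
  have h₁ := lt_finRotate_iff i x
  have h₂ := lt_finRotate_iff i y
  have h₃ := lt_trichotomy x (finRotate n i)
  have h₄ := lt_trichotomy y (finRotate n i)
  simp only [Fin.lt_def, Fin.ext_iff] at *
  omega

theorem numSingletons_eq {n : ℕ} (P : SetPartition n) :
    P.numSingletons = (Finset.univ.filter fun i : Fin n => {i} ∈ P.parts).card := by
  symm
  refine Finset.card_nbij (fun i => {i}) ?_ ?_ ?_
  · intro i hi
    simpa using hi
  · intro i _ j _ hij
    simpa using hij
  · intro B hB
    simp only [Finset.coe_filter, Set.mem_ofPred_eq, Finset.card_eq_one] at hB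
    obtain ⟨hB, i, rfl⟩ := hB
    exact ⟨i, by simpa using hB, rfl⟩

theorem numAdjacencies_krewerasComplement {n : ℕ} (P : SetPartition n) :
    P.krewerasComplement.numAdjacencies = P.numSingletons := by
  rw [numSingletons_eq]
  refine Finset.card_equiv (finRotate n) fun i => ?_
  simp only [Finset.mem_filter, Finset.mem_univ, true_and]
  exact sameBlock_krewerasComplement_finRotate

theorem NonCrossing.numSingletons_krewerasComplement {n : ℕ} {P : SetPartition n}
    (hP : P.NonCrossing) : P.krewerasComplement.numSingletons = P.numAdjacencies := by
  rw [← numAdjacencies_krewerasComplement, hP.krewerasComplement_krewerasComplement,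
    ← numAdjacencies_rotation, Equiv.apply_symm_apply]

/-- R⁻¹ P is a Kreweras complement, and these are always noncrossing. -/
theorem NonCrossing.rotation_inv {n : ℕ} {P : SetPartition n} (hP : P.NonCrossing) :
    ((rotation n)⁻¹ P).NonCrossing := by
  change ((rotation n).symm P).NonCrossing
  rw [← hP.krewerasComplement_krewerasComplement]
  exact nonCrossing_krewerasComplement _

end SetPartition

/-! ### Passage to noncrossing partitions and their rotation classes -/

namespace NCPartition

instance (n : ℕ) : Finite (NCPartition n) :=
  inferInstanceAs (Finite {P : SetPartition n // P.NonCrossing})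

/-- The inverse of the rotation, on noncrossing partitions. -/
def rotationInv (n : ℕ) : Equiv.Perm (NCPartition n) :=
  ((SetPartition.rotation n)⁻¹).subtypePermOfFintype fun _ h => h.rotation_inv

theorem rotationSetoid_iff {n : ℕ} {P Q : NCPartition n} :
    (rotationSetoid n) P Q ↔ (rotationInv n).SameCycle P Q := by
  rw [rotationInv, Equiv.Perm.subtypePermOfFintype]
  exact Equiv.Perm.sameCycle_inv.symm.trans Equiv.Perm.sameCycle_subtypePerm.symm

/-- The Kreweras complement of a noncrossing partition. -/
noncomputable def complement {n : ℕ} (P : NCPartition n) : NCPartition n :=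
  ⟨P.1.krewerasComplement, P.1.nonCrossing_krewerasComplement⟩

theorem complement_complement {n : ℕ} (P : NCPartition n) :
    P.complement.complement = rotationInv n P :=
  Subtype.ext P.2.krewerasComplement_krewerasComplement

/-- The square of the map is a permutation. -/
theorem complement_injective (n : ℕ) : Function.Injective (complement (n := n)) := by
  intro P Q h
  apply (rotationInv n).injective
  rw [← complement_complement, ← complement_complement, h]

/-- The Kreweras complement as a permutation of the noncrossing partitions. -/
noncomputable def complementPerm (n : ℕ) : Equiv.Perm (NCPartition n) :=
  Equiv.ofBijective complement (Finite.injective_iff_bijective.1 (complement_injective n))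

theorem complementPerm_mul_self (n : ℕ) : complementPerm n * complementPerm n = rotationInv n :=
  Equiv.ext complement_complement

/-- K commutes with its own square R⁻¹, and conjugation by K carries cycles of R⁻¹ to cycles. -/
theorem rotationSetoid_complementPerm {n : ℕ} (P Q : NCPartition n) :
    (rotationSetoid n) P Q ↔ (rotationSetoid n) (complementPerm n P) (complementPerm n Q) := by
  have h : complementPerm n * rotationInv n * (complementPerm n)⁻¹ = rotationInv n := by
    rw [← complementPerm_mul_self, mul_assoc, mul_inv_cancel_right]
  rw [rotationSetoid_iff, rotationSetoid_iff]
  conv_rhs => rw [← h, Equiv.Perm.sameCycle_conj]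
  simp

theorem numSingletons_complementPerm {n : ℕ} (P : NCPartition n) :
    (complementPerm n P).numSingletons = P.numAdjacencies :=
  P.2.numSingletons_krewerasComplement

theorem numAdjacencies_complementPerm {n : ℕ} (P : NCPartition n) :
    (complementPerm n P).numAdjacencies = P.numSingletons :=
  P.1.numAdjacencies_krewerasComplement

end NCPartition

namespace CircularNCPartition

/-- The Kreweras complement on circular noncrossing partitions. -/
noncomputable def complementPerm (n : ℕ) : Equiv.Perm (CircularNCPartition n) :=
  Quotient.congr (NCPartition.complementPerm n) NCPartition.rotationSetoid_complementPerm

theorem numSingletons_complementPerm {n : ℕ} (A : CircularNCPartition n) :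
    (complementPerm n A).numSingletons = A.numAdjacencies :=
  Quotient.inductionOn A fun P => P.numSingletons_complementPerm

theorem numAdjacencies_complementPerm {n : ℕ} (A : CircularNCPartition n) :
    (complementPerm n A).numAdjacencies = A.numSingletons :=
  Quotient.inductionOn A fun P => P.numAdjacencies_complementPerm

end CircularNCPartition

theorem mainTheorem5 (n : ℕ) :
    (∀ s t : ℕ,
      Nat.card {P : NCPartition n // P.numSingletons = s ∧ P.numAdjacencies = t} =
        Nat.card {P : NCPartition n // P.numSingletons = t ∧ P.numAdjacencies = s}) ∧
    (∀ k : ℕ,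
      Nat.card {P : NCPartition n // P.numSingletons = k} =
        Nat.card {P : NCPartition n // P.numAdjacencies = k}) ∧
    (∀ s t : ℕ,
      Nat.card {A : CircularNCPartition n // A.numSingletons = s ∧ A.numAdjacencies = t} =
        Nat.card {A : CircularNCPartition n // A.numSingletons = t ∧ A.numAdjacencies = s}) ∧
    (∀ k : ℕ,
      Nat.card {A : CircularNCPartition n // A.numSingletons = k} =
        Nat.card {A : CircularNCPartition n // A.numAdjacencies = k}) := by

  refine ⟨fun s t => ?_, fun k => ?_, fun s t => ?_, fun k => ?_⟩
  · refine Nat.card_congr ((NCPartition.complementPerm n).subtypeEquiv fun P => ?_)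
    rw [P.numSingletons_complementPerm, P.numAdjacencies_complementPerm, and_comm]
  · refine Nat.card_congr ((NCPartition.complementPerm n).subtypeEquiv fun P => ?_)
    rw [P.numAdjacencies_complementPerm]
  · refine Nat.card_congr ((CircularNCPartition.complementPerm n).subtypeEquiv fun A => ?_)
    rw [A.numSingletons_complementPerm, A.numAdjacencies_complementPerm, and_comm]
  · refine Nat.card_congr ((CircularNCPartition.complementPerm n).subtypeEquiv fun A => ?_)
    rw [A.numAdjacencies_complementPerm]
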